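/- A state in $\mathbb{C}^a\otimes\mathbb{C}^b\otimes\mathbb{C}^c$ is a nonzero vector, considered without normalization and shared by three parties $A,B,C$ with a fixed computational basis. A state $\psi$ can be *probabilistically transformed* (by SLOCC) into a state $\phi$ of possibly different local dimensions if $\phi=(X\otimes Y\otimes Z)\psi$ for some (not necessarily invertible) linear operators $X,Y,Z$ acting on the three parties. A *$2\times m\times n$ state* is a state in $\mathbb{C}^2\otimes\mathbb{C}^m\otimes\mathbb{C}^n$ whose reduced density matrices have ranks $2$, $m$ and $n$, respectively. A *common resource* for a set $S$ of states is a state that can be probabilistically transformed into every state in $S$. A common resource $\psi$ for $S$ is *optimal* if for every common resource $\phi$ for $S$, of any local dimensions, either $\phi$ can be probabilistically transformed into $\psi$, or neither of $\psi,\phi$ can be probabilistically transformed into the other. The *pencil* of $\psi=|0\rangle_A|R\rangle_{BC}+|1\rangle_A|S\rangle_{BC}\in\mathbb{C}^2\otimes\mathbb{C}^b\otimes\mathbb{C}^c$, with $R,S\in\mathbb{C}^{b\times c}$, is the matrix $\mu R+\lambda S$ with entries in $\mathbb{C}[\mu,\lambda]$; two $b\times c$ pencils $\mathcal{P},\mathcal{Q}$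 are *strictly equivalent* if $\mathcal{Q}=Y\mathcal{P}Z^T$ for some constant invertible complex matrices $Y,Z$. Let $L_1=(\lambda\ \ \mu)$, and let $mL_1$ be the $m\times 2m$ direct sum of $m$ copies of $L_1$. Let $|\phi_d^+\rangle=\sum_{i=0}^{d-1}|ii\rangle$. **Theorem.** Let $m\ge 2$ and $m<n\le 2m$. The teleportation state $$\tau=|\phi_2^+\rangle_{AC}\otimes|\phi_m^+\rangle_{BC}\in\mathbb{C}^2\otimes\mathbb{C}^m\otimes\mathbb{C}^{2m},$$ where the space $\mathbb{C}^2\otimes\mathbb{C}^m$ of $C$ is identified with $\mathbb{C}^{2m}$ by $|s\rangle\otimes|i\rangle\mapsto|sm+i\rangle$, is a $2\times m\times 2m$ state whose pencil is strictly equivalent to $mL_1$. It is a common resource for the set of all $2\times m\times n$ states, and indeed for the set of all states in $\mathbb{C}^2\otimes\mathbb{C}^m\otimes\mathbb{C}^n$. It is an optimal common resource for the set of all $2\times m\times n$ states. Moreover, no common resource for the set of all $2\times m\times n$ states exists in $\mathbb{C}^2\otimes\mathbb{C}^m\otimes\mathbb{C}^{2m-1}$ or in lower dimensions, that is, in $\mathbb{C}^a\otimes\mathbb{C}^b\otimes\mathbb{C}^c$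 with $a\le 2$, $b\le m$ and $c\le 2m-1$. -/

import Mathlib

open scoped Matrix

/-- Unnormalised pure states of three parties `A`, `B`, `C` in `ℂ^a ⊗ ℂ^b ⊗ ℂ^c`, given by their
amplitudes in the computational basis: `ψ i j k = ⟨i j k | ψ⟩`. A (physical) state is a nonzero
element. -/
abbrev Ket (a b c : ℕ) : Type := Fin a → Fin b → Fin c → ℂ

/-- The action of the local operators `A ⊗ B ⊗ C` on a tripartite vector. -/
def localAct {a b c a' b' c' : ℕ} (A : Matrix (Fin a') (Fin a) ℂ) (B : Matrix (Fin b') (Fin b) ℂ)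
    (C : Matrix (Fin c') (Fin c) ℂ) (ψ : Ket a b c) : Ket a' b' c' :=
  fun i j k => ∑ i' : Fin a, ∑ j' : Fin b, ∑ k' : Fin c, A i i' * B j j' * C k k' * ψ i' j' k'

/-- `ψ` can be transformed into `φ` by stochastic local operations and classical communication,
i.e. with nonzero probability: some (not necessarily invertible) local operators map `ψ` to `φ`.
Normalisation is ignored. The dimensions of `φ` may differ from those of `ψ`. -/
def Reaches {a b c a' b' c' : ℕ} (ψ : Ket a b c) (φ : Ket a' b' c') : Prop :=
  ∃ (A : Matrix (Fin a') (Fin a) ℂ) (B : Matrix (Fin b') (Fin b) ℂ)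
    (C : Matrix (Fin c') (Fin c) ℂ), localAct A B C ψ = φ

/-- The reduced density matrix of `A`. -/
def rhoA {a b c : ℕ} (ψ : Ket a b c) : Matrix (Fin a) (Fin a) ℂ :=
  Matrix.of fun i i' => ∑ j : Fin b, ∑ k : Fin c, ψ i j k * star (ψ i' j k)

/-- The reduced density matrix of `B`. -/
def rhoB {a b c : ℕ} (ψ : Ket a b c) : Matrix (Fin b) (Fin b) ℂ :=
  Matrix.of fun j j' => ∑ i : Fin a, ∑ k : Fin c, ψ i j k * star (ψ i j' k)

/-- The reduced density matrix of `C`. -/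
def rhoC {a b c : ℕ} (ψ : Ket a b c) : Matrix (Fin c) (Fin c) ℂ :=
  Matrix.of fun k k' => ∑ i : Fin a, ∑ j : Fin b, ψ i j k * star (ψ i j k')

/-- `ψ` is truly entangled in all dimensions: its local ranks (the ranks of the three reduced
density matrices) are equal to the local dimensions `a`, `b`, `c`. -/
def TrulyEntangled {a b c : ℕ} (ψ : Ket a b c) : Prop :=
  (rhoA ψ).rank = a ∧ (rhoB ψ).rank = b ∧ (rhoC ψ).rank = c

/-- `ψ` is a common resource for the set `S` of states: it reaches every state in `S`. (The zero
vector reaches only zero vectors, so it is no common resource for a set with a nonzero element.) -/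
def IsCommonResource {a b c a' b' c' : ℕ} (ψ : Ket a b c) (S : Set (Ket a' b' c')) : Prop :=
  ∀ φ ∈ S, Reaches ψ φ

/-- `ψ` is an optimal common resource for `S`: it is a common resource for `S`, and for every
common resource `φ` for `S`, of any local dimensions, either `φ` reaches `ψ`, or neither of the
two reaches the other. -/
def IsOptimalCommonResource {a b c a' b' c' : ℕ} (ψ : Ket a b c) (S : Set (Ket a' b' c')) : Prop :=
  IsCommonResource ψ S ∧
    ∀ (d e f : ℕ) (φ : Ket d e f), IsCommonResource φ S →
      Reaches φ ψ ∨ (¬ Reaches ψ φ ∧ ¬ Reaches φ ψ)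

/-- `b × c` matrices with entries in `ℂ[μ, λ]`, where `μ = X 0` and `λ = X 1`. -/
abbrev PencilMatrix (b c : ℕ) : Type := Matrix (Fin b) (Fin c) (MvPolynomial (Fin 2) ℂ)

/-- The matrix pencil `μ R + λ S` of `ψ = |0⟩_A |R⟩_{BC} + |1⟩_A |S⟩_{BC}`. -/
noncomputable def pencil {b c : ℕ} (ψ : Ket 2 b c) : PencilMatrix b c :=
  Matrix.of fun j k =>
    MvPolynomial.X 0 * MvPolynomial.C (ψ 0 j k) + MvPolynomial.X 1 * MvPolynomial.C (ψ 1 j k)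

/-- Strict equivalence of pencils: `B P Cᵀ = Q` for constant invertible matrices `B`, `C`. -/
def StrictlyEquivalent {b c : ℕ} (P Q : PencilMatrix b c) : Prop :=
  ∃ (B : GL (Fin b) ℂ) (C : GL (Fin c) ℂ),
    (B.val.map MvPolynomial.C : PencilMatrix b b) * P *
      (C.val.map MvPolynomial.C : PencilMatrix c c)ᵀ = Q

/-- The Kronecker block `L_ε`, of size `ε × (ε + 1)`, with `λ` on the diagonal and `μ` on the
superdiagonal. -/
noncomputable def blockL (ε : ℕ) : PencilMatrix ε (ε + 1) :=
  Matrix.of fun i j =>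
    if j = i.castSucc then MvPolynomial.X 1 else if j = i.succ then MvPolynomial.X 0 else 0

/-- The pencil `m L_1 = L_1 ⊕ ⋯ ⊕ L_1` (`m` blocks), of size `m × 2m`: row `i` has `λ` in column
`2 i` and `μ` in column `2 i + 1`. -/
noncomputable def sumL1 (m : ℕ) : PencilMatrix m (2 * m) :=
  Matrix.reindex (Equiv.uniqueProd (Fin m) (Fin 1))
    ((Equiv.prodComm (Fin 2) (Fin m)).trans
      (finProdFinEquiv.trans (finCongr (Nat.mul_comm m 2))))
    (Matrix.blockDiagonal fun _ : Fin m => blockL 1)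

/-- The amplitudes of the unnormalised maximally entangled state `|φ⁺_d⟩ = ∑ i, |i i⟩`. -/
def phiPlus (d : ℕ) (i j : Fin d) : ℂ := if i = j then 1 else 0

/-- The teleportation state `|φ⁺_2⟩_{AC} ⊗ |φ⁺_m⟩_{BC}` in `ℂ^2 ⊗ ℂ^m ⊗ ℂ^{2m}`, where the space
`ℂ^2 ⊗ ℂ^m` of `C` is identified with `ℂ^{2m}` by `|s⟩ ⊗ |i⟩ ↦ |s m + i⟩`. -/
def teleportationState (m : ℕ) : Ket 2 m (2 * m) :=
  fun s i k =>
    phiPlus 2 s (finProdFinEquiv.symm k).1 * phiPlus m i (finProdFinEquiv.symm k).2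

/-! The slices of τ along C form the standard basis of ℂ² ⊗ ℂ^m, so an operator on C alone turns τ
into any state in ℂ² ⊗ ℂ^m ⊗ ℂ^n.

The obstruction is dual. If the slices of a resource in ℂ² ⊗ ℂ^m ⊗ ℂ^c do not span, some nonzero `2
× m` matrix M annihilates them. Reaching a state of full local ranks forces invertible A and B, so
that state inherits an annihilator of the same rank as M. Annihilators of `rowSupportedState` have
rank at most one, while nonzero annihilators of `shiftState` have rank two. No M fits both, which is
`not_isCommonResource_of_annihilates`. If c < 2m, an annihilator exists by counting dimensions.

For optimality, let φ = (A ⊗ B ⊗ C)τ be a common resource. Then A and B are injective because φ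
reaches a state of full local ranks, and C is injective because a kernel vector would be an
annihilator. Left inverses carry φ back to τ, so a common resource that τ reaches also reaches τ. -/

/-! ### Local ranks and flattenings -/

open Matrix ComplexOrder in
/-- `N * Nᴴ` has full rank exactly when the rows of `N` are linearly independent. -/
theorem rank_mul_conjTranspose_eq_iff {a : ℕ} {κ : Type*} [Fintype κ]
    (N : Matrix (Fin a) κ ℂ) :
    (N * Nᴴ).rank = a ↔ ∀ α : Fin a → ℂ, α ᵥ* N = 0 → α = 0 := by
  rw [rank_self_mul_conjTranspose, rank_eq_finrank_span_row,
    ← Set.finrank, eq_comm]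
  have h := linearIndependent_iff_card_eq_finrank_span (R := ℂ) (b := N.row)
  rw [Fintype.card_fin] at h
  rw [← h, ← Matrix.vecMul_injective_iff]
  exact injective_iff_map_eq_zero N.vecMulLinear

theorem rank_rhoA_eq_iff {a b c : ℕ} (ψ : Ket a b c) :
    (rhoA ψ).rank = a ↔
      ∀ α : Fin a → ℂ, (∀ j k, ∑ i, α i * ψ i j k = 0) → α = 0 := by
  have h : rhoA ψ = (Matrix.of fun i (p : Fin b × Fin c) => ψ i p.1 p.2) *
      (Matrix.of fun i (p : Fin b × Fin c) => ψ i p.1 p.2)ᴴ := by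
    ext i i'
    simp [rhoA, Matrix.mul_apply, Fintype.sum_prod_type]
  rw [h, rank_mul_conjTranspose_eq_iff]
  simp [funext_iff, Matrix.vecMul, dotProduct]

theorem rank_rhoB_eq_iff {a b c : ℕ} (ψ : Ket a b c) :
    (rhoB ψ).rank = b ↔
      ∀ β : Fin b → ℂ, (∀ i k, ∑ j, β j * ψ i j k = 0) → β = 0 := by
  have h : rhoB ψ = (Matrix.of fun j (p : Fin a × Fin c) => ψ p.1 j p.2) *
      (Matrix.of fun j (p : Fin a × Fin c) => ψ p.1 j p.2)ᴴ := by
    ext i i'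
    simp [rhoB, Matrix.mul_apply, Fintype.sum_prod_type]
  rw [h, rank_mul_conjTranspose_eq_iff]
  simp [funext_iff, Matrix.vecMul, dotProduct]

theorem rank_rhoC_eq_iff {a b c : ℕ} (ψ : Ket a b c) :
    (rhoC ψ).rank = c ↔
      ∀ γ : Fin c → ℂ, (∀ i j, ∑ k, γ k * ψ i j k = 0) → γ = 0 := by
  have h : rhoC ψ = (Matrix.of fun k (p : Fin a × Fin b) => ψ p.1 p.2 k) *
      (Matrix.of fun k (p : Fin a × Fin b) => ψ p.1 p.2 k)ᴴ := by
    ext i i'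
    simp [rhoC, Matrix.mul_apply, Fintype.sum_prod_type]
  rw [h, rank_mul_conjTranspose_eq_iff]
  simp [funext_iff, Matrix.vecMul, dotProduct]

/-- A state has full local ranks exactly when its three flattenings are injective. -/
theorem trulyEntangled_iff {a b c : ℕ} (ψ : Ket a b c) :
    TrulyEntangled ψ ↔
      (∀ α : Fin a → ℂ, (∀ j k, ∑ i, α i * ψ i j k = 0) → α = 0) ∧
      (∀ β : Fin b → ℂ, (∀ i k, ∑ j, β j * ψ i j k = 0) → β = 0) ∧
      ∀ γ : Fin c → ℂ, (∀ i j, ∑ k, γ k * ψ i j k = 0) → γ = 0 := by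
  rw [TrulyEntangled, rank_rhoA_eq_iff, rank_rhoB_eq_iff, rank_rhoC_eq_iff]

/-! ### Composition of local operators and their effect on local ranks -/

theorem localAct_localAct {a b c a' b' c' a'' b'' c'' : ℕ}
    (A' : Matrix (Fin a'') (Fin a') ℂ) (B' : Matrix (Fin b'') (Fin b') ℂ)
    (C' : Matrix (Fin c'') (Fin c') ℂ) (A : Matrix (Fin a') (Fin a) ℂ)
    (B : Matrix (Fin b') (Fin b) ℂ) (C : Matrix (Fin c') (Fin c) ℂ) (ψ : Ket a b c) :
    localAct A' B' C' (localAct A B C ψ) = localAct (A' * A) (B' * B) (C' * C) ψ := by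
  have flat : ∀ {a b c a' b' c' : ℕ} (A : Matrix (Fin a') (Fin a) ℂ)
      (B : Matrix (Fin b') (Fin b) ℂ) (C : Matrix (Fin c') (Fin c) ℂ) (ψ : Ket a b c) i j k,
      localAct A B C ψ i j k =
        ∑ p : Fin a × Fin b × Fin c, A i p.1 * B j p.2.1 * C k p.2.2 * ψ p.1 p.2.1 p.2.2 := by
    intros
    simp only [localAct, Fintype.sum_prod_type]
  funext i j k
  simp only [flat, Finset.mul_sum]
  rw [Finset.sum_comm]
  refine Finset.sum_congr rfl fun p _ => ?_
  simp only [Matrix.mul_apply, Finset.sum_mul_sum, Fintype.sum_prod_type]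
  simp only [Finset.sum_mul]
  refine Finset.sum_congr rfl fun x _ => ?_
  rw [Finset.sum_comm]
  exact Finset.sum_congr rfl fun y _ => Finset.sum_congr rfl fun z _ => by ring

theorem localAct_one {a b c : ℕ} (ψ : Ket a b c) : localAct 1 1 1 ψ = ψ := by
  funext i j k
  simp [localAct, Matrix.one_apply]

theorem Reaches.trans {a b c a' b' c' a'' b'' c'' : ℕ} {ψ : Ket a b c} {φ : Ket a' b' c'}
    {χ : Ket a'' b'' c''} : Reaches ψ φ → Reaches φ χ → Reaches ψ χ := by
  rintro ⟨A, B, C, rfl⟩ ⟨A', B', C', rfl⟩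
  exact ⟨_, _, _, (localAct_localAct A' B' C' A B C ψ).symm⟩

theorem IsCommonResource.of_reaches {a b c a' b' c' a'' b'' c'' : ℕ} {ψ : Ket a b c}
    {φ : Ket a' b' c'} {S : Set (Ket a'' b'' c'')} (hφ : IsCommonResource φ S)
    (h : Reaches ψ φ) : IsCommonResource ψ S :=
  fun χ hχ => h.trans (hφ χ hχ)

theorem localAct_annihilate_left {a b c a' b' c' : ℕ} {A : Matrix (Fin a') (Fin a) ℂ}
    {B : Matrix (Fin b') (Fin b) ℂ} {C : Matrix (Fin c') (Fin c) ℂ} {ψ : Ket a b c}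
    {α : Fin a' → ℂ} (h : Matrix.vecMul α A = 0) (j : Fin b') (k : Fin c') :
    ∑ i, α i * localAct A B C ψ i j k = 0 := by
  have h' : ∀ x, ∑ i, α i * A i x = 0 := fun x => congrFun h x
  simp only [localAct, Finset.mul_sum]
  rw [Finset.sum_comm]
  refine Finset.sum_eq_zero fun x _ => ?_
  rw [Finset.sum_comm]
  refine Finset.sum_eq_zero fun y _ => ?_
  rw [Finset.sum_comm]
  refine Finset.sum_eq_zero fun z _ => ?_
  rw [← zero_mul (B j y * C k z * ψ x y z), ← h' x, Finset.sum_mul]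
  exact Finset.sum_congr rfl fun i _ => by ring

theorem localAct_annihilate_middle {a b c a' b' c' : ℕ} {A : Matrix (Fin a') (Fin a) ℂ}
    {B : Matrix (Fin b') (Fin b) ℂ} {C : Matrix (Fin c') (Fin c) ℂ} {ψ : Ket a b c}
    {β : Fin b' → ℂ} (h : Matrix.vecMul β B = 0) (i : Fin a') (k : Fin c') :
    ∑ j, β j * localAct A B C ψ i j k = 0 := by
  have h' : ∀ y, ∑ j, β j * B j y = 0 := fun y => congrFun h y
  simp only [localAct, Finset.mul_sum]
  rw [Finset.sum_comm]
  refine Finset.sum_eq_zero fun x _ => ?_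
  rw [Finset.sum_comm]
  refine Finset.sum_eq_zero fun y _ => ?_
  rw [Finset.sum_comm]
  refine Finset.sum_eq_zero fun z _ => ?_
  rw [← zero_mul (A i x * C k z * ψ x y z), ← h' y, Finset.sum_mul]
  exact Finset.sum_congr rfl fun i _ => by ring

/-- A matrix with independent rows has at least as many columns as rows. -/
theorem le_of_vecMul_injective {r s : ℕ} {A : Matrix (Fin r) (Fin s) ℂ}
    (h : ∀ α, Matrix.vecMul α A = 0 → α = 0) : r ≤ s := by
  have := LinearMap.finrank_le_finrank_of_injective (f := A.vecMulLinear)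
    ((injective_iff_map_eq_zero _).2 h)
  simpa using this

theorem isUnit_of_vecMul_injective {r : ℕ} {A : Matrix (Fin r) (Fin r) ℂ}
    (h : ∀ α, Matrix.vecMul α A = 0 → α = 0) : IsUnit A :=
  Matrix.vecMul_injective_iff_isUnit.1 ((injective_iff_map_eq_zero A.vecMulLinear).2 h)

/-- A linear relation among the rows of A persists in the image, where full local rank excludes it.
-/
theorem TrulyEntangled.vecMul_left {a b c a' b' c' : ℕ} {A : Matrix (Fin a') (Fin a) ℂ}
    {B : Matrix (Fin b') (Fin b) ℂ} {C : Matrix (Fin c') (Fin c) ℂ} {ψ : Ket a b c}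
    (h : TrulyEntangled (localAct A B C ψ)) (α) (hα : Matrix.vecMul α A = 0) : α = 0 :=
  ((trulyEntangled_iff _).1 h).1 α (localAct_annihilate_left hα)

theorem TrulyEntangled.vecMul_middle {a b c a' b' c' : ℕ} {A : Matrix (Fin a') (Fin a) ℂ}
    {B : Matrix (Fin b') (Fin b) ℂ} {C : Matrix (Fin c') (Fin c) ℂ} {ψ : Ket a b c}
    (h : TrulyEntangled (localAct A B C ψ)) (β) (hβ : Matrix.vecMul β B = 0) : β = 0 :=
  ((trulyEntangled_iff _).1 h).2.1 β (localAct_annihilate_middle hβ)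

/-! ### Annihilators of the slices along C -/

/-- `M`, read as a functional on `ℂ^a ⊗ ℂ^b`, vanishes on all slices of `ψ` along `C`. -/
def Annihilates {a b c : ℕ} (M : Matrix (Fin a) (Fin b) ℂ) (ψ : Ket a b c) : Prop :=
  ∀ k, ∑ i, ∑ j, M i j * ψ i j k = 0

/-- Pulling the functional M back along A ⊗ B gives Aᵀ M B, and C only forms linear combinations of
slices. -/
theorem Annihilates.localAct {a b c a' b' c' : ℕ} {A : Matrix (Fin a') (Fin a) ℂ}
    {B : Matrix (Fin b') (Fin b) ℂ} {C : Matrix (Fin c') (Fin c) ℂ} {ψ : Ket a b c}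
    {M : Matrix (Fin a') (Fin b') ℂ} (h : Annihilates (Aᵀ * M * B) ψ) :
    Annihilates M (localAct A B C ψ) := by
  intro k
  have h' : ∑ z, C k z * ∑ x, ∑ y, (Aᵀ * M * B) x y * ψ x y z = 0 :=
    Finset.sum_eq_zero fun z _ => by rw [h z, mul_zero]
  rw [← h']
  have e : ∀ x y z, C k z * ((Aᵀ * M * B) x y * ψ x y z) =
      ∑ p : Fin a' × Fin b', M p.1 p.2 * (A p.1 x * B p.2 y * C k z * ψ x y z) := by
    intro x y z
    rw [Fintype.sum_prod_type, Finset.sum_comm]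
    simp only [Matrix.mul_apply, Matrix.transpose_apply, Finset.mul_sum, Finset.sum_mul]
    exact Finset.sum_congr rfl fun _ _ => Finset.sum_congr rfl fun _ _ => by ring
  calc ∑ i, ∑ j, M i j * _root_.localAct A B C ψ i j k
      = ∑ p : Fin a' × Fin b', ∑ q : Fin c × Fin a × Fin b,
          M p.1 p.2 * (A p.1 q.2.1 * B p.2 q.2.2 * C k q.1 * ψ q.2.1 q.2.2 q.1) := by
        rw [Fintype.sum_prod_type]
        refine Finset.sum_congr rfl fun i _ => Finset.sum_congr rfl fun j _ => ?_
        rw [← Finset.mul_sum, Fintype.sum_prod_type, Finset.sum_comm' (t' := Finset.univ)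
          (s' := fun _ => Finset.univ) (by simp), Fintype.sum_prod_type]
        rfl
    _ = _ := by
        rw [Finset.sum_comm, Fintype.sum_prod_type]
        refine Finset.sum_congr rfl fun z _ => ?_
        rw [Fintype.sum_prod_type, Finset.mul_sum]
        refine Finset.sum_congr rfl fun x _ => ?_
        rw [Finset.mul_sum]
        exact Finset.sum_congr rfl fun y _ => (e x y z).symm

/-! ### Two test states with incompatible annihilators -/

/-- A `2 × m × n` state all of whose annihilators are supported on row `0`. -/
def rowSupportedState (m n : ℕ) : Ket 2 m n :=
  fun s i k => if s = 1 then (if (k : ℕ) = i then 1 else 0)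
    else if m ≤ (k : ℕ) ∧ (k : ℕ) + m = n + i then 1 else 0

/-- A `2 × m × n` state none of whose nonzero annihilators has rank one. -/
def shiftState (m n : ℕ) : Ket 2 m n :=
  fun s i k => if s = 0 then (if (k : ℕ) = i then 1 else 0)
    else if (i : ℕ) = 0 then (if (k : ℕ) = m then 1 else 0)
    else if (i : ℕ) ≤ 2 * m - n then (if (k : ℕ) + 1 = i then 1 else 0)
    else if (k : ℕ) + m = n + i then 1 else 0

theorem trulyEntangled_rowSupportedState {m n : ℕ} (hm : 2 ≤ m) (hmn : m < n) (hn : n ≤ 2 * m) :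
    TrulyEntangled (rowSupportedState m n) := by
  rw [trulyEntangled_iff]
  refine ⟨fun α h => ?_, fun β h => ?_, fun γ h => ?_⟩
  · have h1 := h ⟨0, by omega⟩ ⟨0, by omega⟩
    have h0 := h ⟨m - 1, by omega⟩ ⟨n - 1, by omega⟩
    have e1 : ¬ (m = n) := by omega
    have e2 : m ≤ n - 1 ∧ n - 1 + m = n + (m - 1) := by omega
    have e3 : ¬ (n - 1 = m - 1) := by omega
    simp [rowSupportedState, e1] at h1
    simp [rowSupportedState, Fin.sum_univ_two, e2, e3] at h0
    funext s
    fin_cases s <;> simp [h0, h1]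
  · funext j
    have := h 1 ⟨j, by omega⟩
    simpa [rowSupportedState, ← Fin.ext_iff] using this
  · funext k
    by_cases hk : (k : ℕ) < m
    · have := h 1 ⟨k, hk⟩
      simpa [rowSupportedState, ← Fin.ext_iff] using this
    · have := h 0 ⟨k + m - n, by omega⟩
      have e : ∀ k' : Fin n, (m ≤ (k' : ℕ) ∧ (k' : ℕ) + m = n + (k + m - n)) ↔ k' = k := by
        intro k'; rw [Fin.ext_iff]; omega
      simpa [rowSupportedState, e] using this

theorem trulyEntangled_shiftState {m n : ℕ} (hm : 2 ≤ m) (hmn : m < n) (hn : n ≤ 2 * m) :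
    TrulyEntangled (shiftState m n) := by
  rw [trulyEntangled_iff]
  refine ⟨fun α h => ?_, fun β h => ?_, fun γ h => ?_⟩
  · have h1 := h ⟨0, by omega⟩ ⟨0, by omega⟩
    have h0 := h ⟨0, by omega⟩ ⟨m, by omega⟩
    have e1 : ¬ (0 = m) := by omega
    have e2 : ¬ (m = 0) := by omega
    simp [shiftState, e1] at h1
    simp [shiftState, Fin.sum_univ_two, e2] at h0
    funext s
    fin_cases s <;> simp [h0, h1]
  · funext j
    have := h 0 ⟨j, by omega⟩
    simpa [shiftState, ← Fin.ext_iff] using this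
  · funext k
    by_cases hk : (k : ℕ) < m
    · have := h 0 ⟨k, hk⟩
      simpa [shiftState, ← Fin.ext_iff] using this
    · by_cases hk' : (k : ℕ) = m
      · have := h 1 ⟨0, by omega⟩
        have e : ∀ k' : Fin n, ((k' : ℕ) = m) ↔ k' = k := by
          intro k'; rw [Fin.ext_iff]; omega
        simpa [shiftState, e] using this
      · have := h 1 ⟨k + m - n, by omega⟩
        have e : ∀ k' : Fin n, ((k' : ℕ) + m = n + (k + m - n)) ↔ k' = k := by
          intro k'; rw [Fin.ext_iff]; omega
        have e0 : ¬ ((k : ℕ) + m - n = 0) := by omega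
        have e1 : ¬ ((k : ℕ) + m - n ≤ 2 * m - n) := by omega
        simpa only [shiftState, e, e0, e1, if_false, one_ne_zero, mul_ite, mul_one, mul_zero,
          Finset.sum_ite_eq', Finset.mem_univ, if_true, Pi.zero_apply] using this

theorem Annihilates.row_one_eq_zero {m n : ℕ} (hmn : m < n)
    {M : Matrix (Fin 2) (Fin m) ℂ} (h : Annihilates M (rowSupportedState m n)) (j : Fin m) :
    M 1 j = 0 := by
  have := h ⟨j, by omega⟩
  simpa [rowSupportedState, Fin.sum_univ_two, ← Fin.ext_iff, j.isLt.not_ge] using this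

/-- With rows read as coefficient lists of polynomials in t, an annihilator has rows p and -t p with
deg p < 2m - n. A row relation then reads (α₀ - α₁ t) p = 0, so p = 0. -/
theorem Annihilates.eq_zero_of_shiftState {m n : ℕ} (hmn : m < n) (hn : n ≤ 2 * m)
    {M : Matrix (Fin 2) (Fin m) ℂ} (h : Annihilates M (shiftState m n)) {α : Fin 2 → ℂ}
    (hα : α ≠ 0) (hM : ∀ j, α 0 * M 0 j + α 1 * M 1 j = 0) : M = 0 := by
  have row0 : ∀ (k : Fin n) (hk : (k : ℕ) < m) (j : Fin m),
      shiftState m n 0 j k = if j = ⟨k, hk⟩ then 1 else 0 := by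
    intro k hk j
    simp [shiftState, Fin.ext_iff, eq_comm]
  have row0' : ∀ (k : Fin n) (_ : m ≤ (k : ℕ)) (j : Fin m), shiftState m n 0 j k = 0 := by
    intro k hk j
    have : ¬ ((k : ℕ) = j) := by omega
    simp [shiftState, this]
  have row1 : ∀ (k : Fin n) (i : Fin m) (_ : (k : ℕ) = m ∧ (i : ℕ) = 0 ∨
      (i : ℕ) ≤ 2 * m - n ∧ (k : ℕ) + 1 = i ∨ 2 * m - n < i ∧ (k : ℕ) + m = n + i) (j : Fin m),
      shiftState m n 1 j k = if j = i then 1 else 0 := by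
    intro k i hi j
    simp only [shiftState, one_ne_zero, if_false, Fin.ext_iff]
    split_ifs <;> first | rfl | (exfalso; omega)
  have row1' : ∀ (k : Fin n) (_ : 2 * m - n ≤ (k : ℕ)) (_ : (k : ℕ) < m) (j : Fin m),
      shiftState m n 1 j k = 0 := by
    intro k hk hk' j
    simp only [shiftState, one_ne_zero, if_false]
    split_ifs <;> first | rfl | (exfalso; omega)
  have first : ∀ i : Fin m, (i : ℕ) = 0 → M 1 i = 0 := by
    intro i hi
    have := h ⟨m, hmn⟩
    simpa [Fin.sum_univ_two, row0' ⟨m, hmn⟩ le_rfl, row1 ⟨m, hmn⟩ i (Or.inl ⟨rfl, hi⟩)] using this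
  have last : ∀ i : Fin m, 2 * m - n < (i : ℕ) → M 1 i = 0 := by
    intro i hi
    have hk : n + i - m < n := by omega
    have := h ⟨n + i - m, hk⟩
    simpa [Fin.sum_univ_two, row0' ⟨n + i - m, hk⟩ (by simp only; omega),
      row1 ⟨n + i - m, hk⟩ i (Or.inr (Or.inr ⟨hi, by simp only; omega⟩))] using this
  have step : ∀ i i' : Fin m, (i : ℕ) + 1 = i' → (i' : ℕ) ≤ 2 * m - n → M 0 i + M 1 i' = 0 := by
    intro i i' hi hi'
    have hk : (i : ℕ) < n := by omega
    have := h ⟨i, hk⟩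
    simpa [Fin.sum_univ_two, row0 ⟨i, hk⟩ i.isLt,
      row1 ⟨i, hk⟩ i' (Or.inr (Or.inl ⟨hi', hi⟩))] using this
  have free : ∀ i : Fin m, 2 * m - n ≤ (i : ℕ) → M 0 i = 0 := by
    intro i hi
    have hk : (i : ℕ) < n := by omega
    have := h ⟨i, hk⟩
    simpa [Fin.sum_univ_two, row0 ⟨i, hk⟩ i.isLt, row1' ⟨i, hk⟩ hi i.isLt] using this
  have second : ∀ i : Fin m, M 1 i = 0 := by
    by_cases h0 : α 0 = 0
    · have h1 : α 1 ≠ 0 := fun h1 => hα (by funext s; fin_cases s <;> simp [h0, h1])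
      intro i
      simpa [h0, h1] using hM i
    -- Induction along the shift: a zero of row 1 at i gives one of row 0 at i by the row relation,
    -- hence one of row 1 at i + 1 by `step`.
    · rintro ⟨i, hi⟩
      induction i with
      | zero => exact first _ rfl
      | succ i ih =>
        by_cases hd : 2 * m - n < i + 1
        · exact last _ hd
        · have hs := step ⟨i, by omega⟩ ⟨i + 1, hi⟩ rfl (by simp only; omega)
          have h0i : M 0 ⟨i, by omega⟩ = 0 := by
            simpa [ih (by omega), h0] using hM ⟨i, by omega⟩
          simpa [h0i] using hs
  ext s i
  fin_cases s
  · by_cases hd : 2 * m - n ≤ (i : ℕ)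
    · exact free i hd
    · have := step i ⟨i + 1, by omega⟩ rfl (by simp only; omega)
      simpa [second] using this
  · exact second i

/-! ### Nonexistence of smaller common resources -/

/-- A state in `ℂ^2 ⊗ ℂ^m ⊗ ℂ^c` whose slices span a proper subspace of `ℂ^2 ⊗ ℂ^m` is no common
resource for the `2 × m × n` states. -/
theorem not_isCommonResource_of_annihilates {m n c : ℕ} (hm : 2 ≤ m) (hmn : m < n)
    (hn : n ≤ 2 * m) {ψ : Ket 2 m c} {M : Matrix (Fin 2) (Fin m) ℂ} (hM : M ≠ 0)
    (h : Annihilates M ψ) : ¬ IsCommonResource ψ {φ : Ket 2 m n | TrulyEntangled φ} := by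
  intro hψ
  have hinv : ∀ {A : Matrix (Fin 2) (Fin 2) ℂ}, IsUnit A → Aᵀ * (A⁻¹)ᵀ = 1 := fun hA => by
    rw [← Matrix.transpose_mul, Matrix.nonsing_inv_mul _ ((Matrix.isUnit_iff_isUnit_det _).1 hA),
      Matrix.transpose_one]
  have transport : ∀ φ : Ket 2 m n, TrulyEntangled φ → ∃ (A : Matrix (Fin 2) (Fin 2) ℂ)
      (B : Matrix (Fin m) (Fin m) ℂ), IsUnit A ∧ IsUnit B ∧
        Annihilates ((A⁻¹)ᵀ * M * B⁻¹) φ := by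
    intro φ hφ
    obtain ⟨A, B, C, rfl⟩ := hψ φ hφ
    have hA : IsUnit A := isUnit_of_vecMul_injective hφ.vecMul_left
    have hB : IsUnit B := isUnit_of_vecMul_injective hφ.vecMul_middle
    refine ⟨A, B, hA, hB, Annihilates.localAct ?_⟩
    have e : Aᵀ * ((A⁻¹)ᵀ * M * B⁻¹) * B = M := by
      have h2 : B⁻¹ * B = 1 := Matrix.nonsing_inv_mul _ ((Matrix.isUnit_iff_isUnit_det _).1 hB)
      calc _ = (Aᵀ * (A⁻¹)ᵀ) * M * (B⁻¹ * B) := by simp only [Matrix.mul_assoc]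
        _ = M := by rw [hinv hA, h2, Matrix.one_mul, Matrix.mul_one]
    rwa [e]
  have cancel : ∀ (A : Matrix (Fin 2) (Fin 2) ℂ) (α : Fin 2 → ℂ), IsUnit A → α ≠ 0 →
      Matrix.vecMul α A ≠ 0 := by
    intro A α hA hα h0
    exact hα (Matrix.vecMul_injective_of_isUnit hA (by simpa using h0))
  obtain ⟨A₀, B₀, hA₀, hB₀, h₀⟩ := transport _ (trulyEntangled_rowSupportedState hm hmn hn)
  obtain ⟨A₁, B₁, hA₁, hB₁, h₁⟩ := transport _ (trulyEntangled_shiftState hm hmn hn)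
  have hAA : ∀ {A : Matrix (Fin 2) (Fin 2) ℂ}, IsUnit A → IsUnit (A⁻¹)ᵀ := fun hA => by
    rw [Matrix.isUnit_transpose]; exact (Matrix.isUnit_nonsing_inv_iff).2 hA
  have e₀ : Matrix.vecMul (![0, 1] : Fin 2 → ℂ) ((A₀⁻¹)ᵀ * M * B₀⁻¹) = 0 := by
    funext j
    simpa [Matrix.vecMul, dotProduct, Fin.sum_univ_two] using h₀.row_one_eq_zero hmn j
  rw [← Matrix.vecMul_vecMul, ← Matrix.vecMul_vecMul] at e₀
  have e₁ := Matrix.vecMul_injective_of_isUnit ((Matrix.isUnit_nonsing_inv_iff).2 hB₀)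
    (e₀.trans (Matrix.zero_vecMul _).symm)
  -- `e₁` says that this α is a row relation of M itself; it now moves to the annihilator of
  -- `shiftState`.
  set α : Fin 2 → ℂ := Matrix.vecMul ![0, 1] (A₀⁻¹)ᵀ with hα
  have hα0 : α ≠ 0 := cancel _ _ (hAA hA₀) (fun h => by simpa using congrFun h 1)
  set M₁ := (A₁⁻¹)ᵀ * M * B₁⁻¹ with hM₁
  have e₂ : Matrix.vecMul (Matrix.vecMul α A₁ᵀ) M₁ = 0 := by
    rw [hM₁, Matrix.vecMul_vecMul, ← Matrix.mul_assoc, ← Matrix.mul_assoc, hinv hA₁, Matrix.one_mul,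
      ← Matrix.vecMul_vecMul, e₁, Matrix.zero_vecMul]
  have hz : M₁ = 0 := h₁.eq_zero_of_shiftState hmn hn
    (cancel _ _ ((Matrix.isUnit_transpose _).2 hA₁) hα0) (fun j => by
      simpa [Matrix.vecMul, dotProduct, Fin.sum_univ_two] using congrFun e₂ j)
  apply hM
  have hz' : (A₁⁻¹)ᵀ * M = 0 := by
    have := congrArg (· * B₁) hz
    simpa [hM₁, Matrix.mul_assoc,
      Matrix.nonsing_inv_mul _ ((Matrix.isUnit_iff_isUnit_det _).1 hB₁)] using this
  rw [← Matrix.one_mul M, ← hinv hA₁, Matrix.mul_assoc, hz', Matrix.mul_zero]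

/-- The c slices cannot span a space of dimension ab. -/
theorem exists_annihilates_of_lt {a b c : ℕ} (h : c < a * b) (ψ : Ket a b c) :
    ∃ M : Matrix (Fin a) (Fin b) ℂ, M ≠ 0 ∧ Annihilates M ψ := by
  let N : Matrix (Fin c) (Fin a × Fin b) ℂ := Matrix.of fun k p => ψ p.1 p.2 k
  have hk : LinearMap.ker N.mulVecLin ≠ ⊥ := LinearMap.ker_ne_bot_of_finrank_lt (by simpa using h)
  obtain ⟨v, hv, hv0⟩ := (Submodule.ne_bot_iff _).1 hk
  refine ⟨Matrix.of fun i j => v (i, j), fun h0 => hv0 ?_, fun k => ?_⟩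
  · funext p
    exact congrFun (congrFun h0 p.1) p.2
  · have := congrFun (LinearMap.mem_ker.1 hv) k
    simpa [N, Matrix.mulVec, dotProduct, Fintype.sum_prod_type, mul_comm] using this

theorem not_isCommonResource_of_le {m n a b c : ℕ} (hm : 2 ≤ m) (hmn : m < n) (hn : n ≤ 2 * m)
    (ha : a ≤ 2) (hb : b ≤ m) (hc : c ≤ 2 * m - 1) (ψ : Ket a b c) :
    ¬ IsCommonResource ψ {φ : Ket 2 m n | TrulyEntangled φ} := by
  intro hψ
  obtain ⟨A, B, C, h⟩ := hψ _ (trulyEntangled_shiftState hm hmn hn)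
  have hφ := trulyEntangled_shiftState hm hmn hn
  rw [← h] at hφ
  -- Local ranks cannot increase, so a and b are already maximal and only c falls short.
  obtain rfl : a = 2 := le_antisymm ha (le_of_vecMul_injective hφ.vecMul_left)
  obtain rfl : b = m := le_antisymm hb (le_of_vecMul_injective hφ.vecMul_middle)
  obtain ⟨M, hM, hMψ⟩ := exists_annihilates_of_lt (by omega : c < 2 * b) ψ
  exact not_isCommonResource_of_annihilates hm hmn hn hM hMψ hψ

/-! ### The teleportation state and its pencil -/

theorem reaches_of_teleportationState {m n : ℕ} (φ : Ket 2 m n) :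
    Reaches (teleportationState m) φ := by
  refine ⟨1, 1, Matrix.of fun k l =>
    φ (finProdFinEquiv.symm l).1 (finProdFinEquiv.symm l).2 k, ?_⟩
  funext s i k
  simp only [localAct, teleportationState]
  rw [Finset.sum_eq_single s, Finset.sum_eq_single i,
    ← finProdFinEquiv.sum_comp, Fintype.sum_prod_type]
  · simp only [Equiv.symm_apply_apply, phiPlus, Matrix.of_apply]
    simp
  all_goals simp +contextual [Matrix.one_apply, eq_comm]

theorem trulyEntangled_teleportationState {m : ℕ} (hm : 0 < m) :
    TrulyEntangled (teleportationState m) := by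
  rw [trulyEntangled_iff]
  refine ⟨fun α h => ?_, fun β h => ?_, fun γ h => ?_⟩
  · funext s
    simpa [teleportationState, phiPlus] using h ⟨0, hm⟩ (finProdFinEquiv (s, ⟨0, hm⟩))
  · funext i
    simpa [teleportationState, phiPlus] using h 0 (finProdFinEquiv (0, i))
  · funext k
    obtain ⟨⟨s, i⟩, rfl⟩ := finProdFinEquiv.surjective k
    have := h s i
    rw [← finProdFinEquiv.sum_comp, Fintype.sum_prod_type] at this
    simpa [teleportationState, phiPlus] using this

theorem strictlyEquivalent_submatrix {b c : ℕ} (P : PencilMatrix b c) (σ : Equiv.Perm (Fin c)) :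
    StrictlyEquivalent P (P.submatrix id σ) := by
  have h : (1 : Matrix (Fin c) (Fin c) ℂ).submatrix σ id *
      (1 : Matrix (Fin c) (Fin c) ℂ).submatrix id σ = 1 := by
    ext
    simp [Matrix.mul_apply, Matrix.one_apply]
  let C : GL (Fin c) ℂ := ⟨_, _, h, mul_eq_one_comm.1 h⟩
  refine ⟨1, C, ?_⟩
  ext1 i k
  simp [C, Matrix.mul_apply, Matrix.one_apply]

theorem strictlyEquivalent_pencil_teleportationState (m : ℕ) :
    StrictlyEquivalent (pencil (teleportationState m)) (sumL1 m) := by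
  let e : Fin 2 × Fin m ≃ Fin (2 * m) := (Equiv.prodComm (Fin 2) (Fin m)).trans
    (finProdFinEquiv.trans (finCongr (Nat.mul_comm m 2)))
  -- The pencil of τ is (μI | λI), whereas `L_1` lists λ before μ; hence the reversal of `Fin 2`
  -- besides the regrouping of columns.
  let σ : Equiv.Perm (Fin (2 * m)) :=
    e.symm.trans (((Equiv.prodCongr Fin.revPerm (Equiv.refl (Fin m)))).trans finProdFinEquiv)
  have h : sumL1 m = (pencil (teleportationState m)).submatrix id σ := by
    ext1 i k
    obtain ⟨⟨t, j⟩, rfl⟩ := e.surjective k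
    have lhs : sumL1 m i (e (t, j)) = if i = j then blockL 1 0 t else 0 := by
      change Matrix.blockDiagonal (fun _ : Fin m => blockL 1) _ (e.symm (e (t, j))) = _
      rw [Equiv.symm_apply_apply]
      rfl
    have rhs : σ (e (t, j)) = finProdFinEquiv (t.rev, j) := by simp [σ]
    rw [lhs, Matrix.submatrix_apply, rhs]
    simp only [pencil, teleportationState, Equiv.symm_apply_apply, phiPlus, Matrix.of_apply, id]
    by_cases hij : i = j
    · fin_cases t <;> simp [hij, blockL]
    · simp [hij]
  rw [h]
  exact strictlyEquivalent_submatrix _ σ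

/-! ### Optimality -/

theorem exists_mul_eq_one_of_mulVec_injective {r s : ℕ} {A : Matrix (Fin r) (Fin s) ℂ}
    (h : ∀ v, A.mulVec v = 0 → v = 0) : ∃ L : Matrix (Fin s) (Fin r) ℂ, L * A = 1 := by
  obtain ⟨g, hg⟩ := A.mulVecLin.exists_leftInverse_of_injective (LinearMap.ker_eq_bot'.2 h)
  refine ⟨LinearMap.toMatrix' g, ?_⟩
  have := congrArg LinearMap.toMatrix' hg
  rwa [LinearMap.toMatrix'_comp, ← Matrix.toLin'_apply', LinearMap.toMatrix'_toLin',
    LinearMap.toMatrix'_id] at this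

theorem exists_mul_eq_one_of_isUnit_mul {r s : ℕ} {A : Matrix (Fin r) (Fin s) ℂ}
    {A' : Matrix (Fin s) (Fin r) ℂ} (h : IsUnit (A' * A)) :
    ∃ L : Matrix (Fin s) (Fin r) ℂ, L * A = 1 :=
  ⟨(A' * A)⁻¹ * A', by
    rw [Matrix.mul_assoc, Matrix.nonsing_inv_mul _ ((Matrix.isUnit_iff_isUnit_det _).1 h)]⟩

/-- A common resource that the teleportation state reaches is equivalent to it. -/
theorem reaches_teleportationState_of_isCommonResource {m n d e f : ℕ} (hm : 2 ≤ m) (hmn : m < n)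
    (hn : n ≤ 2 * m) {φ : Ket d e f}
    (hφ : IsCommonResource φ {φ : Ket 2 m n | TrulyEntangled φ})
    (h : Reaches (teleportationState m) φ) : Reaches φ (teleportationState m) := by
  obtain ⟨A, B, C, rfl⟩ := h
  have hχ := trulyEntangled_shiftState hm hmn hn
  obtain ⟨A', B', C', h'⟩ := hφ _ hχ
  rw [← h', localAct_localAct] at hχ
  -- The composites from τ to `shiftState` are square on A and B, and full local ranks make them
  -- invertible.
  obtain ⟨LA, hA⟩ := exists_mul_eq_one_of_isUnit_mul (isUnit_of_vecMul_injective hχ.vecMul_left)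
  obtain ⟨LB, hB⟩ := exists_mul_eq_one_of_isUnit_mul (isUnit_of_vecMul_injective hχ.vecMul_middle)
  obtain ⟨LC, hC⟩ : ∃ L : Matrix (Fin (2 * m)) (Fin f) ℂ, L * C = 1 := by
    refine exists_mul_eq_one_of_mulVec_injective fun v hv => ?_
    by_contra hv0
    -- A kernel vector v of C, reshaped to a `2 × m` matrix, annihilates (1 ⊗ 1 ⊗ C)τ. That state
    -- reaches φ through A ⊗ B ⊗ 1, so it is itself a common resource.
    refine not_isCommonResource_of_annihilates hm hmn hn (c := f)
      (ψ := localAct 1 1 C (teleportationState m))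
      (M := Matrix.of fun s i => v (finProdFinEquiv (s, i))) (fun h0 => hv0 ?_) (fun k => ?_)
      (hφ.of_reaches ⟨A, B, 1, by simp [localAct_localAct]⟩)
    · funext k
      obtain ⟨⟨s, i⟩, rfl⟩ := finProdFinEquiv.surjective k
      exact congrFun (congrFun h0 s) i
    · have hk := congrFun hv k
      simp only [Matrix.mulVec, dotProduct] at hk
      rw [← finProdFinEquiv.sum_comp, Fintype.sum_prod_type] at hk
      have slice : ∀ s i, localAct 1 1 C (teleportationState m) s i k =
          C k (finProdFinEquiv (s, i)) := by
        intro s i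
        simp only [localAct, teleportationState]
        rw [Finset.sum_eq_single s, Finset.sum_eq_single i,
          ← finProdFinEquiv.sum_comp, Fintype.sum_prod_type]
        · simp [phiPlus]
        all_goals simp +contextual [Matrix.one_apply, eq_comm]
      simpa [slice, mul_comm] using hk
  exact ⟨LA, LB, LC, by rw [localAct_localAct, hA, hB, hC, localAct_one]⟩

theorem theorem7 (m n : ℕ) (hm : 2 ≤ m) (hmn : m < n) (hn : n ≤ 2 * m) :
    -- the teleportation state is a `2 × m × 2m` state whose pencil is (equivalent to) `m L_1`
    TrulyEntangled (teleportationState m) ∧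
    StrictlyEquivalent (pencil (teleportationState m)) (sumL1 m) ∧
    -- it is a common resource for all `2 × m × n` states, those of smaller local rank included
    IsCommonResource (teleportationState m) {φ : Ket 2 m n | φ ≠ 0} ∧
    IsCommonResource (teleportationState m) {φ : Ket 2 m n | TrulyEntangled φ} ∧
    -- it is optimal
    IsOptimalCommonResource (teleportationState m) {φ : Ket 2 m n | TrulyEntangled φ} ∧
    -- no common resource exists in `2 × m × (2m - 1)` or in lower dimensions
    ∀ a b c : ℕ, a ≤ 2 → b ≤ m → c ≤ 2 * m - 1 →
      ¬ ∃ ψ : Ket a b c, IsCommonResource ψ {φ : Ket 2 m n | TrulyEntangled φ} := by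
  have hτ : ∀ S : Set (Ket 2 m n), IsCommonResource (teleportationState m) S :=
    fun _ φ _ => reaches_of_teleportationState φ
  refine ⟨trulyEntangled_teleportationState (by omega),
    strictlyEquivalent_pencil_teleportationState m, hτ _, hτ _, ⟨hτ _, fun d e f φ hφ => ?_⟩, ?_⟩
  · by_cases h : Reaches φ (teleportationState m)
    · exact Or.inl h
    · exact Or.inr ⟨fun h' => h
        (reaches_teleportationState_of_isCommonResource hm hmn hn hφ h'), h⟩
  · rintro a b c ha hb hc ⟨ψ, hψ⟩
    exact not_isCommonResource_of_le hm hmn hn ha hb hc ψ hψ
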